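/- Fix $p\in(1,\infty)$. For $d\in\mathbb{N}$ let $\mathbb{D}_d=\{(\boldsymbol a,\boldsymbol b)\in[0,1]^d\times[0,1]^d:\ a_j\le b_j \text{ for all } j\}$ and $[\boldsymbol a,\boldsymbol b)=\prod_{j=1}^d[a_j,b_j)$. For points $\boldsymbol x_1,\dots,\boldsymbol x_N\in[0,1)^d$ with real weights $c_1,\dots,c_N$, the generalized extreme $L_p$ discrepancy is $$L_{p,N}^{\rm ext}(\mathcal P,\mathcal A)=\left(\int_{\mathbb{D}_d}\Big|\sum_{k=1}^N c_k\mathbf 1_{[\boldsymbol a,\boldsymbol b)}(\boldsymbol x_k)-\prod_{j=1}^d(b_j-a_j)\Big|^p\,{\rm d}(\boldsymbol a,\boldsymbol b)\right)^{1/p},$$ and the initial discrepancy is $L_{p,0}^{\rm ext}=\big(\int_{\mathbb{D}_d}\prod_{j=1}^d(b_j-a_j)^p\,{\rm d}(\boldsymbol a,\boldsymbol b)\big)^{1/p}$. Let ${\rm disc}_p^{+}(N,d)$ be the infimum of $L_{p,N}^{\rm ext}(\mathcal P,\mathcal A)$ over all $\boldsymbol x_1,\dots,\boldsymbol x_N\in[0,1)^d$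 and all weights $c_1,\dots,c_N\ge0$, and let ${\rm disc}_p^{\rm QMC}(N,d)$ be the infimum over all $\boldsymbol x_1,\dots,\boldsymbol x_N\in[0,1)^d$ with the weights $c_1=\dots=c_N=1/N$. For $\bullet\in\{+,{\rm QMC}\}$ put $$N_p^{{\rm disc},\bullet}(\varepsilon,d)=\min\{N:\ {\rm disc}_p^{\bullet}(N,d)\le\varepsilon\,L_{p,0}^{\rm ext}\},$$ with value $\infty$ if there is no such $N$. **Theorem.** For every $p\in(1,\infty)$ there exists a number $C_p>1$ such that $$N_p^{{\rm disc},+}(\varepsilon,d)\ge C_p^d\,(1-2\varepsilon)\qquad\text{for all } d\in\mathbb{N} \text{ and all } \varepsilon\in[0,\tfrac12),$$ and the same lower bound holds for $N_p^{{\rm disc},{\rm QMC}}(\varepsilon,d)$. In particular, for every $p\in(1,\infty)$ the extreme $L_p$ discrepancy suffers from the curse of dimensionality both for non-negative weights and for QMC weights: for each $\bullet\in\{+,{\rm QMC}\}$ there are $c,\tau,\varepsilon_0>0$ such that $N_p^{{\rm disc},\bullet}(\varepsilon,d)\ge c\,(1+\tau)^d$ for all $\varepsilon\in(0,\varepsilon_0]$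 and all $d\in\mathbb{N}$. -/

import Mathlib

open scoped ENNReal

noncomputable section

namespace ExtremeDisc

/-- The parameter set `𝔻_d = {(a, b) ∈ [0,1]^d × [0,1]^d : a ≤ b}` (coordinatewise order). -/
def boxParams (d : ℕ) : Set ((Fin d → ℝ) × (Fin d → ℝ)) :=
  {ab | ab.1 ∈ Set.Icc 0 1 ∧ ab.2 ∈ Set.Icc 0 1 ∧ ab.1 ≤ ab.2}

/-- The half-open box `[a, b) = [a_1, b_1) × ⋯ × [a_d, b_d)`. -/
def box {d : ℕ} (a b : Fin d → ℝ) : Set (Fin d → ℝ) :=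
  {x | ∀ j, x j ∈ Set.Ico (a j) (b j)}

/-- The half-open unit cube `[0,1)^d`. -/
def unitCube (d : ℕ) : Set (Fin d → ℝ) := box 0 1

/-- The generalized discrepancy function
`Δ([a, b)) = ∑ k, c_k 1_{[a,b)}(x_k) - ∏ j, (b_j - a_j)` of the points `x_k` with weights `c_k`. -/
def localDisc {d N : ℕ} (x : Fin N → Fin d → ℝ) (c : Fin N → ℝ) (a b : Fin d → ℝ) : ℝ :=
  ∑ k, c k * (box a b).indicator (fun _ => (1 : ℝ)) (x k) - ∏ j, (b j - a j)

/-- The generalized extreme `L_p` discrepancy of the points `x_k` with weights `c_k`: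
the `L_p` norm over `𝔻_d` of the generalized discrepancy function. -/
def extDisc (p : ℝ) {d N : ℕ} (x : Fin N → Fin d → ℝ) (c : Fin N → ℝ) : ℝ :=
  (∫ ab in boxParams d, |localDisc x c ab.1 ab.2| ^ p) ^ (1 / p)

/-- The initial extreme `L_p` discrepancy: the `L_p` norm over `𝔻_d` of `(a, b) ↦ vol [a, b)`. -/
def initialDisc (p : ℝ) (d : ℕ) : ℝ :=
  (∫ ab in boxParams d, |∏ j, (ab.2 j - ab.1 j)| ^ p) ^ (1 / p)

/-- The `N`-th minimal extreme `L_p` discrepancy for non-negative weights: the infimum over all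
`x_1, …, x_N ∈ [0,1)^d` and all `c_1, …, c_N ≥ 0`. -/
def minDiscNonneg (p : ℝ) (N d : ℕ) : ℝ :=
  sInf {r | ∃ (x : Fin N → Fin d → ℝ) (c : Fin N → ℝ),
    (∀ k, x k ∈ unitCube d) ∧ (∀ k, 0 ≤ c k) ∧ r = extDisc p x c}

/-- The `N`-th minimal extreme `L_p` discrepancy for QMC weights `c_1 = ⋯ = c_N = 1/N`: the
infimum over all `x_1, …, x_N ∈ [0,1)^d`. -/
def minDiscQMC (p : ℝ) (N d : ℕ) : ℝ :=
  sInf {r | ∃ x : Fin N → Fin d → ℝ,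
    (∀ k, x k ∈ unitCube d) ∧ r = extDisc p x (fun _ => 1 / (N : ℝ))}

/-- `N_p^{disc,+}(ε, d)`: the least `N` for which the `N`-th minimal extreme `L_p` discrepancy for
non-negative weights is at most `ε` times the initial one; it is `∞` if there is no such `N`. -/
def invDiscNonneg (p ε : ℝ) (d : ℕ) : ℕ∞ :=
  sInf ((fun N : ℕ => (N : ℕ∞)) '' {N : ℕ | minDiscNonneg p N d ≤ ε * initialDisc p d})

/-- `N_p^{disc,QMC}(ε, d)`: the same quantity for QMC weights. -/
def invDiscQMC (p ε : ℝ) (d : ℕ) : ℕ∞ :=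
  sInf ((fun N : ℕ => (N : ℕ∞)) '' {N : ℕ | minDiscQMC p N d ≤ ε * initialDisc p d})

/-- The curse of dimensionality for an inverse discrepancy `n(ε, d)`: it grows at least
exponentially in `d`, that is, there are `c > 0`, `τ > 0` and `ε₀ > 0` such that
`n(ε, d) ≥ c (1 + τ)^d` for all `ε ∈ (0, ε₀]` and all `d`. -/
def CurseOfDimensionality (n : ℝ → ℕ → ℕ∞) : Prop :=
  ∃ c τ ε₀ : ℝ, 0 < c ∧ 0 < τ ∧ 0 < ε₀ ∧ ∀ (ε : ℝ) (d : ℕ), 0 < ε → ε ≤ ε₀ →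
    ENNReal.ofReal (c * (1 + τ) ^ d) ≤ (n ε d : ℝ≥0∞)

end ExtremeDisc

end

open MeasureTheory Set

/-! On a box containing no sample point the discrepancy function is minus the volume, whatever the
weights. So it suffices that the boxes through one point `x` carry only an exponentially small share
of the integral of `vol ^ p`. That integral factorizes over coordinates. In dimension one the
intervals containing `t` miss all intervals in one half of `[0,1]`, so they carry a share at most `ρ
< 1`, uniformly in `t` (`exists_setIntegral_straddle_le`). Hence `N` points account for at most `N *
ρ ^ d` of the total (`le_setIntegral_localDisc_rpow`), and `C = ρ⁻¹` works. -/

namespace ExtremeDisc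

/-! ### Intervals in dimension one -/

/-- The one-dimensional parameter set `{(a, b) : 0 ≤ a ≤ b ≤ 1}`. -/
def triangle : Set (ℝ × ℝ) := {q | 0 ≤ q.1 ∧ q.1 ≤ q.2 ∧ q.2 ≤ 1}

/-- The pairs `(a, b)` with `t ∈ [a, b)`. -/
def straddle (t : ℝ) : Set (ℝ × ℝ) := {q | q.1 ≤ t ∧ t < q.2}

lemma isClosed_triangle : IsClosed triangle :=
  (isClosed_le continuous_const continuous_fst).inter
    ((isClosed_le continuous_fst continuous_snd).inter
      (isClosed_le continuous_snd continuous_const))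

lemma isCompact_triangle : IsCompact triangle :=
  ((isCompact_Icc (a := (0 : ℝ)) (b := 1)).prod (isCompact_Icc (a := (0 : ℝ)) (b := 1))).of_isClosed_subset
    isClosed_triangle fun _ hq => ⟨⟨hq.1, hq.2.1.trans hq.2.2⟩, ⟨hq.1.trans hq.2.1, hq.2.2⟩⟩

lemma measurableSet_straddle (t : ℝ) : MeasurableSet (straddle t) :=
  (measurableSet_le measurable_fst measurable_const).inter
    (measurableSet_lt measurable_const measurable_snd)

lemma continuous_length_rpow {p : ℝ} (hp : 0 < p) :
    Continuous fun q : ℝ × ℝ => |q.2 - q.1| ^ p :=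
  (continuous_snd.sub continuous_fst).abs.rpow_const fun _ => Or.inr hp.le

lemma integrableOn_length_rpow {p : ℝ} (hp : 0 < p) :
    IntegrableOn (fun q : ℝ × ℝ => |q.2 - q.1| ^ p) triangle :=
  (continuous_length_rpow hp).continuousOn.integrableOn_compact isCompact_triangle

lemma setIntegral_length_rpow_pos {p : ℝ} (hp : 0 < p) {s : Set (ℝ × ℝ)}
    (hs : s ⊆ triangle) {q : ℝ × ℝ} (hq : q ∈ interior s) (hne : q.1 ≠ q.2) :
    0 < ∫ q in s, |q.2 - q.1| ^ p := by
  rw [setIntegral_pos_iff_support_of_nonneg_ae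
    (Filter.Eventually.of_forall fun q => by positivity) ((integrableOn_length_rpow hp).mono_set hs)]
  have hopen : IsOpen (interior s ∩ {q : ℝ × ℝ | q.1 ≠ q.2}) :=
    isOpen_interior.inter (isOpen_ne_fun continuous_fst continuous_snd)
  refine (hopen.measure_pos volume ⟨q, hq, hne⟩).trans_le (measure_mono ?_)
  rintro r ⟨hr, hr'⟩
  refine ⟨?_, interior_subset hr⟩
  have : 0 < |r.2 - r.1| := abs_pos.2 (sub_ne_zero.2 (Ne.symm hr'))
  exact (Real.rpow_pos_of_pos this p).ne'

lemma setIntegral_triangle_pos {p : ℝ} (hp : 0 < p) :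
    0 < ∫ q in triangle, |q.2 - q.1| ^ p := by
  refine setIntegral_length_rpow_pos hp subset_rfl (q := (1 / 3, 2 / 3)) ?_ (by norm_num)
  refine mem_interior.2 ⟨{q | 0 < q.1 ∧ q.1 < q.2 ∧ q.2 < 1},
    fun q hq => ⟨hq.1.le, hq.2.1.le, hq.2.2.le⟩, ?_, by norm_num⟩
  exact (isOpen_lt continuous_const continuous_fst).inter
    ((isOpen_lt continuous_fst continuous_snd).inter (isOpen_lt continuous_snd continuous_const))

/-- Whatever the point `t` is, the intervals containing it carry at most a fixed proportion
`ρ < 1` of the integral of the `p`-th power of the length. -/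
lemma exists_setIntegral_straddle_le {p : ℝ} (hp : 0 < p) :
    ∃ ρ : ℝ, 0 < ρ ∧ ρ < 1 ∧ ∀ t : ℝ, ∫ q in triangle ∩ straddle t, |q.2 - q.1| ^ p ≤
      ρ * ∫ q in triangle, |q.2 - q.1| ^ p := by
  set W := ∫ q in triangle, |q.2 - q.1| ^ p with hW
  have hW0 : 0 < W := setIntegral_triangle_pos hp
  have hI := integrableOn_length_rpow hp
  -- Intervals inside the left and the right half: every `t` is missed by all of `L` or by all of
  -- `R`.
  set L : Set (ℝ × ℝ) := {q | 0 < q.1 ∧ q.1 < q.2 ∧ q.2 < 1 / 2}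
  set R : Set (ℝ × ℝ) := {q | 1 / 2 < q.1 ∧ q.1 < q.2 ∧ q.2 < 1}
  have hopen (a b : ℝ) : IsOpen {q : ℝ × ℝ | a < q.1 ∧ q.1 < q.2 ∧ q.2 < b} :=
    (isOpen_lt continuous_const continuous_fst).inter
      ((isOpen_lt continuous_fst continuous_snd).inter (isOpen_lt continuous_snd continuous_const))
  have hLT : L ⊆ triangle := fun q hq => ⟨hq.1.le, hq.2.1.le, by linarith [hq.2.2]⟩
  have hRT : R ⊆ triangle := fun q hq => ⟨by linarith [hq.1], hq.2.1.le, hq.2.2.le⟩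
  have hL : 0 < ∫ q in L, |q.2 - q.1| ^ p := by
    refine setIntegral_length_rpow_pos hp hLT (q := (1 / 6, 1 / 3)) ?_ (by norm_num)
    rw [(hopen 0 (1 / 2)).interior_eq]
    norm_num
  have hR : 0 < ∫ q in R, |q.2 - q.1| ^ p := by
    refine setIntegral_length_rpow_pos hp hRT (q := (2 / 3, 5 / 6)) ?_ (by norm_num)
    rw [(hopen (1 / 2) 1).interior_eq]
    norm_num
  -- Below both masses, `δ` serves every `t`; below `W`, it keeps `ρ = 1 - δ / W` positive.
  obtain ⟨δ, hδ0, hδ⟩ := exists_between (lt_min hW0 (lt_min hL hR))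
  simp only [lt_min_iff] at hδ
  refine ⟨1 - δ / W, ?_, ?_, fun t => ?_⟩
  · rw [sub_pos, div_lt_one hW0]; exact hδ.1
  · have : 0 < δ / W := by positivity
    linarith
  · have hmiss : δ ≤ ∫ q in triangle \ straddle t, |q.2 - q.1| ^ p := by
      have hmono {s : Set (ℝ × ℝ)} (hs : s ⊆ triangle \ straddle t) :
          ∫ q in s, |q.2 - q.1| ^ p ≤ ∫ q in triangle \ straddle t, |q.2 - q.1| ^ p :=
        setIntegral_mono_set (hI.mono_set sdiff_subset)
          (Filter.Eventually.of_forall fun q => by positivity) hs.eventuallyLE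
      rcases le_total t (1 / 2) with ht | ht
      · exact hδ.2.2.le.trans (hmono fun q hq => ⟨hRT hq, fun h => by linarith [hq.1, h.1]⟩)
      · exact hδ.2.1.le.trans (hmono fun q hq => ⟨hLT hq, fun h => by linarith [hq.2.2, h.2]⟩)
    have hsplit := integral_inter_add_sdiff (measurableSet_straddle t) hI
    rw [← hW] at hsplit
    have : (1 - δ / W) * W = W - δ := by field_simp
    linarith

/-! ### Factorization over coordinates -/

lemma indicator_prod_length_rpow (p : ℝ) {d : ℕ} (s : Fin d → Set (ℝ × ℝ))
    (ab : (Fin d → ℝ) × (Fin d → ℝ)) :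
    {ab : (Fin d → ℝ) × (Fin d → ℝ) | ∀ j, (ab.1 j, ab.2 j) ∈ s j}.indicator
        (fun ab => |∏ j, (ab.2 j - ab.1 j)| ^ p) ab =
      ∏ j, (s j).indicator (fun q => |q.2 - q.1| ^ p) (ab.1 j, ab.2 j) := by
  by_cases h : ∀ j, (ab.1 j, ab.2 j) ∈ s j
  · rw [indicator_of_mem (by simpa using h), Finset.abs_prod,
      ← Real.finsetProd_rpow _ _ fun _ _ => abs_nonneg _]
    exact Finset.prod_congr rfl fun j _ => by rw [indicator_of_mem (h j)]
  · rw [indicator_of_notMem (by simpa using h)]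
    push Not at h
    obtain ⟨j, hj⟩ := h
    exact (Finset.prod_eq_zero (Finset.mem_univ j) (indicator_of_notMem hj _)).symm

lemma setIntegral_prod_length_rpow (p : ℝ) {d : ℕ} (s : Fin d → Set (ℝ × ℝ))
    (hs : ∀ j, MeasurableSet (s j)) :
    ∫ ab in {ab : (Fin d → ℝ) × (Fin d → ℝ) | ∀ j, (ab.1 j, ab.2 j) ∈ s j},
        |∏ j, (ab.2 j - ab.1 j)| ^ p =
      ∏ j, ∫ q in s j, |q.2 - q.1| ^ p := by
  have hS : MeasurableSet {ab : (Fin d → ℝ) × (Fin d → ℝ) | ∀ j, (ab.1 j, ab.2 j) ∈ s j} := by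
    rw [ofPred_forall]
    exact MeasurableSet.iInter fun j => (hs j).preimage (by fun_prop)
  simp_rw [← integral_indicator hS, ← integral_indicator (hs _)]
  -- Fubini applies after regrouping `ℝ^d × ℝ^d` as `(ℝ × ℝ)^d`, which preserves volume.
  rw [← integral_fintype_prod_volume_eq_prod, ← (volume_measurePreserving_arrowProdEquivProdArrow
    ℝ ℝ (Fin d)).integral_comp']
  refine integral_congr_ae (Filter.Eventually.of_forall fun q => ?_)
  exact indicator_prod_length_rpow p s (fun j => (q j).1, fun j => (q j).2)

lemma boxParams_eq (d : ℕ) :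
    boxParams d = {ab | ∀ j, (ab.1 j, ab.2 j) ∈ triangle} := by
  ext ab
  simp only [boxParams, triangle, mem_ofPred_eq, mem_Icc, Pi.le_def, Pi.zero_apply, Pi.one_apply]
  constructor
  · rintro ⟨⟨h1, -⟩, ⟨-, h4⟩, h5⟩ j
    exact ⟨h1 j, h5 j, h4 j⟩
  · intro h
    exact ⟨⟨fun j => (h j).1, fun j => (h j).2.1.trans (h j).2.2⟩,
      ⟨fun j => (h j).1.trans (h j).2.1, fun j => (h j).2.2⟩, fun j => (h j).2.1⟩

lemma isCompact_boxParams (d : ℕ) : IsCompact (boxParams d) :=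
  ((isCompact_Icc (a := (0 : Fin d → ℝ)) (b := 1)).prod
    (isCompact_Icc (a := (0 : Fin d → ℝ)) (b := 1))).of_isClosed_subset
    ((isClosed_Icc.preimage continuous_fst).inter ((isClosed_Icc.preimage continuous_snd).inter
      (isClosed_le continuous_fst continuous_snd))) fun _ h => ⟨h.1, h.2.1⟩

/-- The parameters `(a, b)` of the boxes `[a, b)` that contain `x`. -/
def boxesThrough {d : ℕ} (x : Fin d → ℝ) : Set ((Fin d → ℝ) × (Fin d → ℝ)) :=
  {ab | x ∈ box ab.1 ab.2}

lemma measurableSet_boxesThrough {d : ℕ} (x : Fin d → ℝ) : MeasurableSet (boxesThrough x) := by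
  have : boxesThrough x = ⋂ j, {ab | (ab.1 j, ab.2 j) ∈ straddle (x j)} := by
    ext ab; simp [boxesThrough, box, straddle]
  rw [this]
  exact MeasurableSet.iInter fun j => (measurableSet_straddle _).preimage (by fun_prop)

lemma setIntegral_boxParams (p : ℝ) (d : ℕ) :
    ∫ ab in boxParams d, |∏ j, (ab.2 j - ab.1 j)| ^ p =
      (∫ q in triangle, |q.2 - q.1| ^ p) ^ d := by
  rw [boxParams_eq, setIntegral_prod_length_rpow p _ fun _ => isClosed_triangle.measurableSet]
  simp

/-- Source of the exponential decay: each coordinate contributes one factor `ρ`. -/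
lemma setIntegral_boxesThrough_le {p ρ : ℝ} {d : ℕ}
    (hρ : ∀ t : ℝ, ∫ q in triangle ∩ straddle t, |q.2 - q.1| ^ p ≤
      ρ * ∫ q in triangle, |q.2 - q.1| ^ p) (x : Fin d → ℝ) :
    ∫ ab in boxParams d ∩ boxesThrough x, |∏ j, (ab.2 j - ab.1 j)| ^ p ≤
      ρ ^ d * ∫ ab in boxParams d, |∏ j, (ab.2 j - ab.1 j)| ^ p := by
  have : boxParams d ∩ boxesThrough x =
      {ab | ∀ j, (ab.1 j, ab.2 j) ∈ triangle ∩ straddle (x j)} := by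
    ext ab
    simp [boxParams_eq, boxesThrough, box, straddle, forall_and]
  rw [this, setIntegral_prod_length_rpow p _ fun _ =>
    isClosed_triangle.measurableSet.inter (measurableSet_straddle _), setIntegral_boxParams,
    ← mul_pow]
  refine (Finset.prod_le_prod (fun j _ => integral_nonneg fun q => by positivity)
    fun j _ => hρ (x j)).trans_eq ?_
  simp

lemma continuous_volume_rpow {p : ℝ} (hp : 0 < p) (d : ℕ) :
    Continuous fun ab : (Fin d → ℝ) × (Fin d → ℝ) => |∏ j, (ab.2 j - ab.1 j)| ^ p :=
  (by fun_prop : Continuous fun ab : (Fin d → ℝ) × (Fin d → ℝ) =>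
    |∏ j, (ab.2 j - ab.1 j)|).rpow_const fun _ => Or.inr hp.le

lemma abs_prod_length_le_one {d : ℕ} {ab : (Fin d → ℝ) × (Fin d → ℝ)} (h : ab ∈ boxParams d) :
    |∏ j, (ab.2 j - ab.1 j)| ≤ 1 := by
  rw [boxParams_eq] at h
  rw [Finset.abs_prod]
  refine Finset.prod_le_one (fun _ _ => abs_nonneg _) fun j _ => ?_
  have := h j
  rw [abs_le]
  constructor <;> linarith [this.1, this.2.1, this.2.2]

/-! ### Lower bound for the discrepancy -/

lemma integrableOn_localDisc_rpow {p : ℝ} (hp : 0 < p) {d N : ℕ} (x : Fin N → Fin d → ℝ)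
    (c : Fin N → ℝ) :
    IntegrableOn (fun ab => |localDisc x c ab.1 ab.2| ^ p) (boxParams d) := by
  have hmeas : Measurable fun ab : (Fin d → ℝ) × (Fin d → ℝ) => |localDisc x c ab.1 ab.2| ^ p := by
    have h (k : Fin N) : Measurable fun ab : (Fin d → ℝ) × (Fin d → ℝ) =>
        (box ab.1 ab.2).indicator (fun _ => (1 : ℝ)) (x k) :=
      (measurable_const (a := (1 : ℝ))).indicator (measurableSet_boxesThrough (x k))
    refine Measurable.pow_const (Measurable.abs ?_) p
    unfold localDisc
    refine Measurable.sub (Finset.measurable_fun_sum _ fun k _ => (h k).const_mul _) ?_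
    fun_prop
  refine Measure.integrableOn_of_bounded (M := (∑ k, |c k| + 1) ^ p)
    (isCompact_boxParams d).measure_lt_top.ne hmeas.aestronglyMeasurable ?_
  refine (ae_restrict_iff' (isCompact_boxParams d).measurableSet).2
    (Filter.Eventually.of_forall fun ab hab => ?_)
  rw [Real.norm_of_nonneg (by positivity)]
  refine Real.rpow_le_rpow (abs_nonneg _) ?_ hp.le
  refine (abs_sub _ _).trans (add_le_add ?_ (abs_prod_length_le_one hab))
  refine (Finset.abs_sum_le_sum_abs _ _).trans (Finset.sum_le_sum fun k _ => ?_)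
  rw [abs_mul]
  refine mul_le_of_le_one_right (abs_nonneg _) ?_
  by_cases hk : x k ∈ box ab.1 ab.2 <;> simp [hk]

/-- The boxes containing no point of the point set already force a large discrepancy: there the
discrepancy function is minus the volume. -/
lemma volume_rpow_sub_le_localDisc_rpow (p : ℝ) {d N : ℕ} (x : Fin N → Fin d → ℝ)
    (c : Fin N → ℝ) (ab : (Fin d → ℝ) × (Fin d → ℝ)) :
    |∏ j, (ab.2 j - ab.1 j)| ^ p - ∑ k, (boxesThrough (x k)).indicator
      (fun ab => |∏ j, (ab.2 j - ab.1 j)| ^ p) ab ≤ |localDisc x c ab.1 ab.2| ^ p := by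
  by_cases h : ∃ k, x k ∈ box ab.1 ab.2
  -- The summand of the point in the box already cancels the volume term, so the left side is at
  -- most `0`.
  · obtain ⟨k, hk⟩ := h
    have h1 := Finset.single_le_sum (f := fun k => (boxesThrough (x k)).indicator
      (fun ab => |∏ j, (ab.2 j - ab.1 j)| ^ p) ab)
      (fun k _ => indicator_nonneg (fun _ _ => by positivity) _) (Finset.mem_univ k)
    have h2 : ab ∈ boxesThrough (x k) := hk
    rw [indicator_of_mem h2] at h1
    have h3 : 0 ≤ |localDisc x c ab.1 ab.2| ^ p := by positivity
    linarith
  · push Not at h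
    have h1 : localDisc x c ab.1 ab.2 = -∏ j, (ab.2 j - ab.1 j) := by
      simp [localDisc, h]
    rw [h1, abs_neg, sub_le_self_iff]
    exact Finset.sum_nonneg fun k _ => indicator_nonneg (fun _ _ => by positivity) _

/-- Union bound: integrate the pointwise inequality, each point costing at most a share `ρ ^ d`. -/
lemma le_setIntegral_localDisc_rpow {p ρ : ℝ} (hp : 0 < p) {d N : ℕ}
    (hρ : ∀ t : ℝ, ∫ q in triangle ∩ straddle t, |q.2 - q.1| ^ p ≤
      ρ * ∫ q in triangle, |q.2 - q.1| ^ p) (x : Fin N → Fin d → ℝ) (c : Fin N → ℝ) :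
    (1 - N * ρ ^ d) * ∫ ab in boxParams d, |∏ j, (ab.2 j - ab.1 j)| ^ p ≤
      ∫ ab in boxParams d, |localDisc x c ab.1 ab.2| ^ p := by
  have hV : IntegrableOn (fun ab : (Fin d → ℝ) × (Fin d → ℝ) => |∏ j, (ab.2 j - ab.1 j)| ^ p)
      (boxParams d) :=
    (continuous_volume_rpow hp d).continuousOn.integrableOn_compact (isCompact_boxParams d)
  have hVk (k : Fin N) : IntegrableOn ((boxesThrough (x k)).indicator
      fun ab => |∏ j, (ab.2 j - ab.1 j)| ^ p) (boxParams d) :=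
    hV.indicator (measurableSet_boxesThrough _)
  have hsum := integrable_finsetSum Finset.univ fun k _ => hVk k
  refine le_trans ?_ (integral_mono (hV.sub hsum) (integrableOn_localDisc_rpow hp x c)
    fun ab => volume_rpow_sub_le_localDisc_rpow p x c ab)
  simp only [Pi.sub_apply]
  rw [integral_sub hV hsum, integral_finsetSum _ fun k _ => hVk k, sub_mul, one_mul]
  refine sub_le_sub_left ?_ _
  have hk (k : Fin N) := setIntegral_boxesThrough_le hρ (x k)
  calc _ ≤ ∑ _k : Fin N, ρ ^ d * ∫ ab in boxParams d, |∏ j, (ab.2 j - ab.1 j)| ^ p := by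
        refine Finset.sum_le_sum fun k _ => ?_
        rw [setIntegral_indicator (measurableSet_boxesThrough _)]
        exact hk k
    _ = _ := by simp [mul_assoc]

lemma initialDisc_pos {p : ℝ} (hp : 0 < p) (d : ℕ) : 0 < initialDisc p d := by
  rw [initialDisc, setIntegral_boxParams]
  exact Real.rpow_pos_of_pos (pow_pos (setIntegral_triangle_pos hp) _) _

/-- A lower bound for the extreme discrepancy, valid for arbitrary real weights. -/
lemma le_extDisc {p ρ : ℝ} (hp : 1 < p) (hρ0 : 0 < ρ) {d N : ℕ}
    (hρ : ∀ t : ℝ, ∫ q in triangle ∩ straddle t, |q.2 - q.1| ^ p ≤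
      ρ * ∫ q in triangle, |q.2 - q.1| ^ p) (x : Fin N → Fin d → ℝ) (c : Fin N → ℝ) :
    (1 - N * ρ ^ d) * initialDisc p d ≤ extDisc p x c := by
  have hp0 : 0 < p := by linarith
  have hext : 0 ≤ extDisc p x c :=
    Real.rpow_nonneg (integral_nonneg fun _ => by positivity) _
  rcases le_total (1 - N * ρ ^ d) 0 with h | h
  · exact (mul_nonpos_of_nonpos_of_nonneg h (initialDisc_pos hp0 d).le).trans hext
  have h1 : 1 - N * ρ ^ d ≤ 1 := by
    have : 0 ≤ N * ρ ^ d := by positivity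
    linarith
  -- Here `p > 1` enters: a base in `[0,1]` only grows under the exponent `1 / p ≤ 1`.
  have h2 : 1 - N * ρ ^ d ≤ (1 - N * ρ ^ d) ^ (1 / p) := by
    refine Real.self_le_rpow_of_le_one h h1 ?_
    rw [div_le_one hp0]
    exact hp.le
  calc (1 - N * ρ ^ d) * initialDisc p d
      ≤ (1 - N * ρ ^ d) ^ (1 / p) * initialDisc p d :=
        mul_le_mul_of_nonneg_right h2 (initialDisc_pos hp0 d).le
    _ = ((1 - N * ρ ^ d) * ∫ ab in boxParams d, |∏ j, (ab.2 j - ab.1 j)| ^ p) ^ (1 / p) :=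
        (Real.mul_rpow h (integral_nonneg fun _ => by positivity)).symm
    _ ≤ extDisc p x c := by
        refine Real.rpow_le_rpow ?_ (le_setIntegral_localDisc_rpow hp0 hρ x c) (by positivity)
        exact mul_nonneg h (integral_nonneg fun _ => by positivity)

/-! ### From discrepancy to its inverse -/

lemma zero_mem_unitCube (d : ℕ) : (0 : Fin d → ℝ) ∈ unitCube d := fun _ => by simp

lemma le_minDiscNonneg {p r : ℝ} {N d : ℕ}
    (h : ∀ (x : Fin N → Fin d → ℝ) (c : Fin N → ℝ), r ≤ extDisc p x c) :
    r ≤ minDiscNonneg p N d := by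
  -- A competitor is needed, since the real infimum of the empty set is `0`.
  refine le_csInf ⟨_, fun _ => 0, fun _ => 0, fun _ => zero_mem_unitCube d, fun _ => le_rfl, rfl⟩ ?_
  rintro _ ⟨x, c, -, -, rfl⟩
  exact h x c

lemma le_minDiscQMC {p r : ℝ} {N d : ℕ}
    (h : ∀ (x : Fin N → Fin d → ℝ) (c : Fin N → ℝ), r ≤ extDisc p x c) :
    r ≤ minDiscQMC p N d := by
  refine le_csInf ⟨_, fun _ => 0, fun _ => zero_mem_unitCube d, rfl⟩ ?_
  rintro _ ⟨x, -, rfl⟩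
  exact h x _

lemma ofReal_le_sInf_natCast {r : ℝ} {S : Set ℕ} (h : ∀ N ∈ S, r ≤ N) :
    ENNReal.ofReal r ≤ ((sInf ((fun N : ℕ => (N : ℕ∞)) '' S) : ℕ∞) : ℝ≥0∞) := by
  rcases S.eq_empty_or_nonempty with rfl | hS
  -- No admissible `N`: the infimum in `ℕ∞` is `⊤`.
  · simp
  · obtain ⟨N, hN, hN'⟩ := csInf_mem (hS.image fun N : ℕ => (N : ℕ∞))
    rw [← hN', ENat.toENNReal_coe, ← ENNReal.ofReal_natCast]
    exact ENNReal.ofReal_le_ofReal (h N hN)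

lemma curseOfDimensionality_of_le {n : ℝ → ℕ → ℕ∞} {C : ℝ} (hC : 1 < C)
    (h : ∀ (d : ℕ) (ε : ℝ), 0 ≤ ε → ε < 1 / 2 →
      ENNReal.ofReal (C ^ d * (1 - 2 * ε)) ≤ (n ε d : ℝ≥0∞)) :
    CurseOfDimensionality n := by
  -- For `ε ≤ 1 / 4` the factor `1 - 2 * ε` is at least `1 / 2`.
  refine ⟨1 / 2, C - 1, 1 / 4, by norm_num, by linarith, by norm_num, fun ε d hε hε' => ?_⟩
  refine le_trans (ENNReal.ofReal_le_ofReal ?_) (h d ε hε.le (by linarith))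
  rw [add_sub_cancel, mul_comm]
  exact mul_le_mul_of_nonneg_left (by linarith) (by positivity)

end ExtremeDisc

open ExtremeDisc in
theorem mainTheorem2 (p : ℝ) (hp : 1 < p) :
    (∃ C : ℝ, 1 < C ∧ ∀ (d : ℕ) (ε : ℝ), 0 ≤ ε → ε < 1 / 2 →
      ENNReal.ofReal (C ^ d * (1 - 2 * ε)) ≤ (ExtremeDisc.invDiscNonneg p ε d : ℝ≥0∞) ∧
      ENNReal.ofReal (C ^ d * (1 - 2 * ε)) ≤ (ExtremeDisc.invDiscQMC p ε d : ℝ≥0∞)) ∧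
    ExtremeDisc.CurseOfDimensionality (fun ε d => ExtremeDisc.invDiscNonneg p ε d) ∧
    ExtremeDisc.CurseOfDimensionality (fun ε d => ExtremeDisc.invDiscQMC p ε d) := by
  have hp0 : 0 < p := by linarith
  obtain ⟨ρ, hρ0, hρ1, hρ⟩ := exists_setIntegral_straddle_le hp0
  have key (d N : ℕ) (ε : ℝ) (hε : 0 ≤ ε)
      (h : (1 - N * ρ ^ d) * initialDisc p d ≤ ε * initialDisc p d) :
      ρ⁻¹ ^ d * (1 - 2 * ε) ≤ N := by
    have h1 := le_of_mul_le_mul_right h (initialDisc_pos hp0 d)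
    rw [inv_pow, inv_mul_le_iff₀ (pow_pos hρ0 d)]
    -- `h1` gives `1 - ε ≤ N * ρ ^ d`, stronger than needed as `ε ≥ 0`.
    linarith
  have main : ∀ (d : ℕ) (ε : ℝ), 0 ≤ ε → ε < 1 / 2 →
      ENNReal.ofReal (ρ⁻¹ ^ d * (1 - 2 * ε)) ≤ (invDiscNonneg p ε d : ℝ≥0∞) ∧
      ENNReal.ofReal (ρ⁻¹ ^ d * (1 - 2 * ε)) ≤ (invDiscQMC p ε d : ℝ≥0∞) := fun d ε hε _ =>
    ⟨ofReal_le_sInf_natCast fun N hN => key d N ε hε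
      ((le_minDiscNonneg fun x c => le_extDisc hp hρ0 hρ x c).trans hN),
    ofReal_le_sInf_natCast fun N hN => key d N ε hε
      ((le_minDiscQMC fun x c => le_extDisc hp hρ0 hρ x c).trans hN)⟩
  have hC : 1 < ρ⁻¹ := (one_lt_inv₀ hρ0).2 hρ1
  exact ⟨⟨ρ⁻¹, hC, main⟩,
    curseOfDimensionality_of_le hC fun d ε h h' => (main d ε h h').1,
    curseOfDimensionality_of_le hC fun d ε h h' => (main d ε h h').2⟩
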